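/- Let $1<p<\infty$, let $\mathbb T=\{t\in\mathbb C:|t|=1\}$, let $H^p=\{f\in L^p(\mathbb T):\hat f(n)=0 \text{ for } n<0\}$, and let $P:L^p(\mathbb T)\to L^p(\mathbb T)$, $\sum_{n\in\mathbb Z} f_nt^n\mapsto\sum_{n\ge 0}f_nt^n$, be the (bounded) Riesz projection, with range $H^p$; put $Q=I-P$ and $(Jf)(t)=\bar t\,f(\bar t)$. For $a\in L^\infty=L^\infty(\mathbb T)$ put $\widetilde a(t)=a(1/t)$, and define the Toeplitz operator $T(a):H^p\to H^p$, $T(a)f=P(af)$, and the Hankel operator $H(a):H^p\to H^p$, $H(a)f=P(a\,QJf)$. For a $2\times 2$ matrix function $U=(u_{ij})$ with entries in $L^\infty$ let $T(U):H^p\times H^p\to H^p\times H^p$ be the operator with operator matrix $(T(u_{ij}))$. For a bounded operator $A$ on a Banach space $X$ put $\operatorname{coker}A=\ker A^*\subseteq X^*$. The operator $A$ is Fredholm if its range is closed and $\ker A$, $\operatorname{coker}A$ are finite-dimensional; then $\operatorname{ind}A=\dim\ker A-\dim\operatorname{coker}A$. **Theorem.** Let $a\in L^\infty$ be invertible in $L^\infty$,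 let $b\in L^\infty$, and let $$U(a,b)=\begin{pmatrix} a-b\,\widetilde b\,\widetilde a^{-1} & -b\,\widetilde a^{-1}\\ \widetilde b\,\widetilde a^{-1} & \widetilde a^{-1}\end{pmatrix}.$$ Consider the operators $D=\operatorname{diag}(T(a)+H(b),\,T(a)-H(b))$ and $T(U(a,b))$ on $H^p\times H^p$. 1. $D$ is Fredholm if and only if $T(U(a,b))$ is Fredholm. 2. If they are Fredholm, then $\operatorname{ind}D=\operatorname{ind}T(U(a,b))$. 3. Moreover (Fredholm or not, with dimensions understood as cardinal numbers), $\dim\ker D=\dim\ker T(U(a,b))$ and $\dim\operatorname{coker}D=\dim\operatorname{coker}T(U(a,b))$. -/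

import Mathlib

namespace ToeplitzHankel

open MeasureTheory Complex Set
open scoped ENNReal Real ComplexConjugate

/-! ### The unit circle -/

instance : Fact ((0 : ℝ) < 2 * π) := ⟨Real.two_pi_pos⟩

/-- The unit circle `𝕋 = ℝ / 2πℤ`, the class of `θ` standing for the point `t = e^{iθ}`; thus `-x`
stands for `1/t = t̄`, and `fourier n` is the function `t ↦ tⁿ`. -/
abbrev Torus : Type := AddCircle (2 * π)

/-- Lebesgue measure on the unit circle, normalised by `(2π)⁻¹` to total mass `1`. -/
noncomputable abbrev torusMeasure : Measure Torus := AddCircle.haarAddCircle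

/-! ### Boundedness of the Riesz projection

The statements named `rieszAux...` prove the theorem of M. Riesz, `exists_rieszProjection`: for
`1 < p < ∞` the Riesz projection is a bounded operator on `L^p(𝕋)`. -/

theorem rieszAux_rpow_bound {p : ℝ} (h1 : 1 < p) (h2 : p ≤ 2) :
    ∃ A B : ℝ, 0 ≤ A ∧ 0 ≤ B ∧ ∀ z : ℂ, 0 < z.re →
      ‖z‖ ^ p ≤ A * z.re ^ p - B * (z ^ (p : ℂ)).re := by
  have hpi := Real.pi_pos
  set φ₀ : ℝ := π * (1 + p) / (4 * p) with hφ₀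
  have hp0 : 0 < p := by linarith
  have e1 : p * φ₀ = π * (1 + p) / 4 := by rw [hφ₀]; field_simp
  have hφ₀pos : 0 < φ₀ := by positivity
  have hφ₀lt : φ₀ < π / 2 := by
    rw [hφ₀, div_lt_div_iff₀ (by positivity) (by norm_num)]; nlinarith
  have hc0 : Real.cos (p * φ₀) < 0 := by
    apply Real.cos_neg_of_pi_div_two_lt_of_lt <;> rw [e1] <;> nlinarith
  have hc1 : 0 < Real.cos φ₀ := Real.cos_pos_of_mem_Ioo ⟨by linarith, hφ₀lt⟩
  set B : ℝ := -1 / Real.cos (p * φ₀) with hB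
  have hB0 : 0 < B := div_pos_of_neg_of_neg (by norm_num) hc0
  set A : ℝ := (1 + B) / Real.cos φ₀ ^ p with hA
  have hcp : 0 < Real.cos φ₀ ^ p := Real.rpow_pos_of_pos hc1 p
  have hA0 : 0 < A := by positivity
  refine ⟨A, B, hA0.le, hB0.le, fun z hz => ?_⟩
  have hn : 0 ≤ ‖z‖ := norm_nonneg z
  have harg : |arg z| < π / 2 := abs_arg_lt_pi_div_two_iff.2 (Or.inl hz)
  have hcosz : 0 < Real.cos |arg z| :=
    Real.cos_pos_of_mem_Ioo ⟨by linarith [abs_nonneg (arg z)], harg⟩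
  have hre : z.re = ‖z‖ * Real.cos |arg z| := by rw [Real.cos_abs, norm_mul_cos_arg]
  have hpow : (z ^ (p : ℂ)).re = ‖z‖ ^ p * Real.cos (p * |arg z|) := by
    rw [cpow_ofReal_re, ← Real.cos_abs (arg z * p), abs_mul, abs_of_pos hp0, mul_comm p]
  rw [hpow, hre, Real.mul_rpow hn hcosz.le]
  have key : 1 ≤ A * Real.cos |arg z| ^ p - B * Real.cos (p * |arg z|) := by
    rcases le_total φ₀ |arg z| with h | h
    · have h3 : Real.cos (p * |arg z|) ≤ Real.cos (p * φ₀) := by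
        apply Real.cos_le_cos_of_nonneg_of_le_pi
        · positivity
        · nlinarith
        · exact mul_le_mul_of_nonneg_left h hp0.le
      have h4 : B * Real.cos (p * φ₀) = -1 := by rw [hB]; exact div_mul_cancel₀ _ hc0.ne
      have h5 : 0 ≤ A * Real.cos |arg z| ^ p := by positivity
      nlinarith
    · have h3 : Real.cos φ₀ ≤ Real.cos |arg z| := by
        apply Real.cos_le_cos_of_nonneg_of_le_pi (abs_nonneg _) (by linarith) h
      have h4 : Real.cos φ₀ ^ p ≤ Real.cos |arg z| ^ p := Real.rpow_le_rpow hc1.le h3 hp0.le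
      have h5 : A * Real.cos φ₀ ^ p = 1 + B := by rw [hA]; field_simp
      have h6 := Real.cos_le_one (p * |arg z|)
      nlinarith [mul_le_mul_of_nonneg_left h4 hA0.le]
  have := mul_le_mul_of_nonneg_left key (Real.rpow_nonneg hn p)
  linarith

/-- the analytic function on the plane with real part the one of the trigonometric polynomial -/
noncomputable def rieszAux_fun (c : ℤ →₀ ℂ) (z : ℂ) : ℂ :=
  c.sum fun n w => if 0 < n then w * z ^ n.toNat else if n < 0 then conj w * z ^ (-n).toNat
    else (w.re : ℂ)

theorem rieszAux_fun_add (c d : ℤ →₀ ℂ) (z : ℂ) :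
    rieszAux_fun (c + d) z = rieszAux_fun c z + rieszAux_fun d z := by
  unfold rieszAux_fun
  apply Finsupp.sum_add_index
  · intro n _; simp
  · intro n _ w v
    split_ifs <;> (try simp) <;> ring

theorem rieszAux_fun_sub (c d : ℤ →₀ ℂ) (z : ℂ) :
    rieszAux_fun (c - d) z = rieszAux_fun c z - rieszAux_fun d z := by
  unfold rieszAux_fun
  apply Finsupp.sum_sub_index
  intro n w v
  split_ifs <;> (try simp) <;> ring

theorem rieszAux_fun_differentiable (c : ℤ →₀ ℂ) : Differentiable ℂ (rieszAux_fun c) := by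
  unfold rieszAux_fun Finsupp.sum
  refine Differentiable.fun_sum fun n _ => ?_
  dsimp only
  split_ifs <;> fun_prop

theorem rieszAux_fun_zero (c : ℤ →₀ ℂ) : (rieszAux_fun c 0).im = 0 := by
  unfold rieszAux_fun Finsupp.sum
  rw [Complex.im_sum]
  refine Finset.sum_eq_zero fun n _ => ?_
  dsimp only
  split_ifs with h1 h2
  · rw [zero_pow (by omega)]; simp
  · rw [zero_pow (by omega)]; simp
  · simp

theorem rieszAux_re_pos {F : ℂ → ℂ} (hF : Differentiable ℂ F)
    (hpos : ∀ z : ℂ, ‖z‖ = 1 → 0 < (F z).re) : ∀ z : ℂ, ‖z‖ ≤ 1 → 0 < (F z).re := by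
  obtain ⟨z₀, hz₀, hmin⟩ := (isCompact_sphere (0 : ℂ) 1).exists_isMinOn
    (NormedSpace.sphere_nonempty.2 zero_le_one)
    ((Complex.continuous_re.comp hF.continuous).continuousOn)
  intro z hz
  have h := norm_le_of_forall_mem_frontier_norm_le (U := Metric.ball (0 : ℂ) 1)
    (f := fun z => Complex.exp (- F z)) (C := Real.exp (-(F z₀).re)) Metric.isBounded_ball
    (Differentiable.diffContOnCl (by fun_prop)) (by
      intro w hw
      rw [frontier_ball _ one_ne_zero] at hw
      rw [Complex.norm_exp]
      have := hmin hw
      simpa using this) (z := z) (by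
      rw [closure_ball _ one_ne_zero]; simpa using hz)
  rw [Complex.norm_exp, Real.exp_le_exp] at h
  have := hpos z₀ (by simpa using hz₀)
  simp at h
  linarith

theorem rieszAux_mean {p : ℝ} (h1 : 1 < p) (h2 : p ≤ 2) : ∃ A : ℝ, 0 ≤ A ∧
    ∀ F : ℂ → ℂ, Differentiable ℂ F → (F 0).im = 0 → (∀ z : ℂ, ‖z‖ = 1 → 0 < (F z).re) →
      Real.circleAverage (fun z => ‖F z‖ ^ p) 0 1
        ≤ A * Real.circleAverage (fun z => (F z).re ^ p) 0 1 := by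
  obtain ⟨A, B, hA, hB, hAB⟩ := rieszAux_rpow_bound h1 h2
  refine ⟨A, hA, fun F hF h0 hpos => ?_⟩
  have hpos' := rieszAux_re_pos hF hpos
  have hp0 : 0 ≤ p := by linarith
  have hG : DiffContOnCl ℂ (fun z => F z ^ (p : ℂ)) (Metric.ball 0 |1|) := by
    apply DifferentiableOn.diffContOnCl
    rw [abs_one, closure_ball _ one_ne_zero]
    intro z hz
    apply DifferentiableAt.differentiableWithinAt
    exact (hF z).cpow (by fun_prop) (Or.inl (hpos' z (by simpa using hz)))
  have hav := hG.circleAverage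
  have hcont : ContinuousOn (fun z => F z ^ (p : ℂ)) (Metric.sphere 0 |1|) :=
    hG.continuousOn.mono (by
      rw [abs_one, closure_ball _ one_ne_zero]; exact Metric.sphere_subset_closedBall)
  have hci : CircleIntegrable (fun z => F z ^ (p : ℂ)) 0 1 := hcont.circleIntegrable'
  have hre0 : 0 ≤ Real.circleAverage (fun z => (F z ^ (p : ℂ)).re) 0 1 := by
    have : Real.circleAverage (fun z => (F z ^ (p : ℂ)).re) 0 1 = ((F 0) ^ (p : ℂ)).re := by
      rw [← hav]
      exact (Complex.reCLM.circleAverage_comp_comm hci)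
    rw [this]
    have hF0 : F 0 = ((F 0).re : ℂ) := by apply Complex.ext <;> simp [h0]
    rw [hF0, ← Complex.ofReal_cpow (hpos' 0 (by simp)).le, Complex.ofReal_re]
    exact Real.rpow_nonneg (hpos' 0 (by simp)).le p
  have c1 : CircleIntegrable (fun z => ‖F z‖ ^ p) 0 1 := by
    refine ContinuousOn.circleIntegrable' (Continuous.continuousOn ?_)
    exact hF.continuous.norm.rpow_const fun _ => Or.inr hp0
  have c2 : CircleIntegrable (fun z => (F z).re ^ p) 0 1 := by
    refine ContinuousOn.circleIntegrable' (Continuous.continuousOn ?_)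
    exact (Complex.continuous_re.comp hF.continuous).rpow_const fun _ => Or.inr hp0
  have c3 : CircleIntegrable (fun z => (F z ^ (p : ℂ)).re) 0 1 := 
    (Complex.continuous_re.comp_continuousOn hcont).circleIntegrable'
  calc Real.circleAverage (fun z => ‖F z‖ ^ p) 0 1
      ≤ Real.circleAverage (A • (fun z => (F z).re ^ p) - B • (fun z => (F z ^ (p : ℂ)).re)) 0 1 := by
        apply Real.circleAverage_mono c1 ((c2.const_smul).sub (c3.const_smul))
        intro z hz
        exact hAB _ (hpos z (by simpa using hz))
    _ = A * Real.circleAverage (fun z => (F z).re ^ p) 0 1 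
        - B * Real.circleAverage (fun z => (F z ^ (p : ℂ)).re) 0 1 := by
        rw [Real.circleAverage_sub c2.const_smul c3.const_smul, Real.circleAverage_smul,
          Real.circleAverage_smul]; rfl
    _ ≤ _ := by nlinarith

theorem rieszAux_circleAverage (g : ℂ → ℝ) :
    Real.circleAverage g 0 1 = ∫ x : Torus, g (AddCircle.toCircle x) ∂torusMeasure := by
  rw [torusMeasure, AddCircle.integral_haarAddCircle, ← AddCircle.intervalIntegral_preimage _ 0,
    Real.circleAverage_def]
  simp [AddCircle.toCircle_apply_mk, circleMap]

/-- The trigonometric polynomial with coefficients `c`. -/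
noncomputable abbrev trigPoly : (ℤ →₀ ℂ) →ₗ[ℂ] C(Torus, ℂ) :=
  Finsupp.linearCombination ℂ (fun n : ℤ => (fourier n : C(Torus, ℂ)))

theorem rieszAux_fourier (n : ℤ) (x : Torus) :
    (fourier n x : ℂ) = (AddCircle.toCircle x : ℂ) ^ n := by
  rw [fourier_apply, AddCircle.toCircle_zsmul]; simp

theorem rieszAux_fun_single (n : ℤ) (w : ℂ) (z : ℂ) :
    rieszAux_fun (Finsupp.single n w) z = if 0 < n then w * z ^ n.toNat else
      if n < 0 then conj w * z ^ (-n).toNat else (w.re : ℂ) := by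
  unfold rieszAux_fun
  rw [Finsupp.sum_single_index]
  split_ifs <;> simp

theorem rieszAux_inv (n : ℤ) (hn : n < 0) (x : Torus) :
    (AddCircle.toCircle x : ℂ) ^ n = conj ((AddCircle.toCircle x : ℂ) ^ (-n).toNat) := by
  rw [map_pow, ← Circle.coe_inv_eq_conj, Circle.coe_inv, inv_pow, ← zpow_natCast, ← zpow_neg]
  congr 1; omega

theorem rieszAux_re (c : ℤ →₀ ℂ) (x : Torus) :
    (rieszAux_fun c (AddCircle.toCircle x)).re = (trigPoly c x).re := by
  induction c using Finsupp.induction_linear with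
  | zero => simp [rieszAux_fun]
  | add f g hf hg => rw [rieszAux_fun_add, map_add, ContinuousMap.add_apply, add_re, add_re, hf, hg]
  | single n w =>
    rw [rieszAux_fun_single, trigPoly, Finsupp.linearCombination_single, ContinuousMap.smul_apply,
      rieszAux_fourier, smul_eq_mul]
    split_ifs with h1 h2
    · rw [← zpow_natCast, Int.toNat_of_nonneg h1.le]
    · rw [rieszAux_inv n h2, mul_re, mul_re, conj_re, conj_im, conj_re, conj_im]; ring
    · obtain rfl : n = 0 := by omega
      simp

theorem rieszAux_proj (c : ℤ →₀ ℂ) (x : Torus) :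
    2 * trigPoly (c.filter (0 ≤ ·)) x = rieszAux_fun c (AddCircle.toCircle x)
      - I * rieszAux_fun (I • c) (AddCircle.toCircle x) + c 0 := by
  induction c using Finsupp.induction_linear with
  | zero => rw [Finsupp.filter_zero]; simp [rieszAux_fun]
  | add f g hf hg =>
    rw [smul_add, rieszAux_fun_add, rieszAux_fun_add, Finsupp.filter_add, map_add,
      ContinuousMap.add_apply, Finsupp.add_apply]
    linear_combination hf + hg
  | single n w =>
    rw [Finsupp.smul_single, rieszAux_fun_single, rieszAux_fun_single]
    split_ifs with h1 h2
    · rw [Finsupp.filter_single_of_pos _ h1.le, trigPoly, Finsupp.linearCombination_single,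
        ContinuousMap.smul_apply, rieszAux_fourier, smul_eq_mul, Finsupp.single_eq_of_ne (by omega),
        ← zpow_natCast, Int.toNat_of_nonneg h1.le, smul_eq_mul]
      linear_combination w * (AddCircle.toCircle x : ℂ) ^ n * I_sq
    · rw [Finsupp.filter_single_of_neg _ (by omega), Finsupp.single_eq_of_ne (by omega)]
      simp
      linear_combination -conj w * (AddCircle.toCircle x : ℂ) ^ (-n).toNat * I_sq
    · obtain rfl : n = 0 := by omega
      rw [Finsupp.filter_single_of_pos _ le_rfl]
      apply Complex.ext <;> simp <;> ring

theorem rieszAux_norm (p : ℝ≥0∞) [Fact (1 ≤ p)] (hp : p ≠ ∞) (f : C(Torus, ℂ)) :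
    ‖ContinuousMap.toLp p torusMeasure ℂ f‖
      = (∫ x, ‖f x‖ ^ p.toReal ∂torusMeasure) ^ (p.toReal)⁻¹ := by
  have hp1 : (1 : ℝ≥0∞) ≤ p := Fact.out
  have hp0 : p ≠ 0 := (zero_lt_one.trans_le hp1).ne'
  rw [Lp.norm_def, eLpNorm_congr_ae (ContinuousMap.coeFn_toLp torusMeasure f),
    MemLp.eLpNorm_eq_integral_rpow_norm hp0 hp (ContinuousMap.memLp torusMeasure ℂ f)]
  rw [ENNReal.toReal_ofReal]
  positivity

theorem rieszAux_norm_mono (p : ℝ≥0∞) [Fact (1 ≤ p)] (f g : C(Torus, ℂ))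
    (h : ∀ x, ‖f x‖ ≤ ‖g x‖) :
    ‖ContinuousMap.toLp p torusMeasure ℂ f‖ ≤ ‖ContinuousMap.toLp p torusMeasure ℂ g‖ := by
  apply Lp.norm_le_norm_of_ae_le
  filter_upwards [ContinuousMap.coeFn_toLp (p := p) (𝕜 := ℂ) torusMeasure f,
    ContinuousMap.coeFn_toLp (p := p) (𝕜 := ℂ) torusMeasure g] with x h1 h2
  rw [h1, h2]; exact h x

theorem rieszAux_norm_le (p : ℝ≥0∞) [Fact (1 ≤ p)] (f : C(Torus, ℂ)) :
    ‖ContinuousMap.toLp p torusMeasure ℂ f‖ ≤ ‖f‖ := by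
  have := (ContinuousMap.toLp p torusMeasure ℂ : C(Torus, ℂ) →L[ℂ] _).le_of_opNorm_le
    (ContinuousMap.toLp_norm_le torusMeasure) f
  simpa [measureUnivNNReal] using this

/-- the boundary values of `rieszAux_fun` as a continuous function -/
noncomputable def rieszAux_bd (c : ℤ →₀ ℂ) : C(Torus, ℂ) where
  toFun x := rieszAux_fun c (AddCircle.toCircle x)
  continuous_toFun := (rieszAux_fun_differentiable c).continuous.comp
    (continuous_induced_dom.comp AddCircle.continuous_toCircle)

theorem rieszAux_pos (p : ℝ≥0∞) [Fact (1 ≤ p)] (h1 : 1 < p) (h2 : p ≤ 2) : ∃ A : ℝ, 0 ≤ A ∧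
    ∀ c : ℤ →₀ ℂ, (∀ x, 0 < (trigPoly c x).re) →
      ‖ContinuousMap.toLp p torusMeasure ℂ (rieszAux_bd c)‖
        ≤ A * ‖ContinuousMap.toLp p torusMeasure ℂ (trigPoly c)‖ := by
  have hp : p ≠ ∞ := (h2.trans_lt (by simp)).ne
  have h1' : 1 < p.toReal := by
    rw [← ENNReal.toReal_one]; exact (ENNReal.toReal_lt_toReal (by simp) hp).2 h1
  have h2' : p.toReal ≤ 2 := by
    rw [← ENNReal.toReal_ofNat]; exact (ENNReal.toReal_le_toReal hp (by simp)).2 h2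
  obtain ⟨A, hA, hAF⟩ := rieszAux_mean h1' h2'
  refine ⟨A ^ (p.toReal)⁻¹, by positivity, fun c hc => ?_⟩
  have hsurj : ∀ z : ℂ, ‖z‖ = 1 → ∃ x : Torus, (AddCircle.toCircle x : ℂ) = z := by
    intro z hz
    obtain ⟨x, hx⟩ := (AddCircle.homeomorphCircle (T := 2 * π) (by positivity)).surjective
      ⟨z, by simpa [Submonoid.unitSphere] using hz⟩
    refine ⟨x, ?_⟩
    rw [AddCircle.homeomorphCircle_apply] at hx
    rw [hx]
  have key := hAF (rieszAux_fun c) (rieszAux_fun_differentiable c) (rieszAux_fun_zero c) (by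
    intro z hz
    obtain ⟨x, rfl⟩ := hsurj z hz
    rw [rieszAux_re]; exact hc x)
  rw [rieszAux_circleAverage, rieszAux_circleAverage] at key
  rw [rieszAux_norm p hp, rieszAux_norm p hp]
  have hI : 0 ≤ ∫ x, ‖trigPoly c x‖ ^ p.toReal ∂torusMeasure :=
    integral_nonneg fun x => by positivity
  rw [← Real.mul_rpow hA hI]
  apply Real.rpow_le_rpow (integral_nonneg fun x => by positivity) _ (by positivity)
  refine key.trans (mul_le_mul_of_nonneg_left ?_ hA)
  have hco : ∀ f : Torus → ℝ, Continuous f → Integrable f torusMeasure := fun f hf =>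
    (BoundedContinuousFunction.mkOfCompact ⟨f, hf⟩).integrable torusMeasure
  apply integral_mono
  · apply hco
    simp_rw [rieszAux_re]
    exact (Complex.continuous_re.comp (trigPoly c).continuous).rpow_const fun _ => Or.inr (by linarith)
  · apply hco
    exact (trigPoly c).continuous.norm.rpow_const fun _ => Or.inr (by linarith)
  · intro x
    simp only [rieszAux_re]
    exact Real.rpow_le_rpow (hc x).le ((le_abs_self _).trans (Complex.abs_re_le_norm _))
      (by linarith)

theorem rieszAux_bound {p : ℝ≥0∞} [Fact (1 ≤ p)] (h1 : 1 < p) (h2 : p ≤ 2) : ∃ A : ℝ, 0 ≤ A ∧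
    ∀ c : ℤ →₀ ℂ, ‖ContinuousMap.toLp p torusMeasure ℂ (rieszAux_bd c)‖
        ≤ A * ‖ContinuousMap.toLp p torusMeasure ℂ (trigPoly c)‖ := by
  obtain ⟨A, hA, hAc⟩ := rieszAux_pos p h1 h2
  refine ⟨A * 3, by positivity, fun c => ?_⟩
  set N := ‖ContinuousMap.toLp p torusMeasure ℂ (trigPoly c)‖ with hN
  have main : ∀ ε : ℝ, 0 < ε →
      ‖ContinuousMap.toLp p torusMeasure ℂ (rieszAux_bd c)‖ ≤ A * 3 * N + A * 6 * ε := by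
    intro ε hε
    let g₀ : C(Torus, ℂ) := ⟨fun x => (‖trigPoly c x‖ : ℂ), by fun_prop⟩
    let g : C(Torus, ℂ) := g₀ + ContinuousMap.const _ ((2 * ε : ℝ) : ℂ)
    have hmem : g ∈ (Submodule.span ℂ (range <| @fourier (2 * π))).topologicalClosure := by
      rw [span_fourier_closure_eq_top]; trivial
    rw [← SetLike.mem_coe, Submodule.topologicalClosure_coe, Metric.mem_closure_iff] at hmem
    obtain ⟨w, hw, hwg⟩ := hmem ε hε
    rw [SetLike.mem_coe, ← Finsupp.range_linearCombination] at hw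
    obtain ⟨d, rfl⟩ := hw
    change dist g (trigPoly d) < ε at hwg
    rw [dist_comm, dist_eq_norm] at hwg
    have hre : ∀ x, ‖trigPoly c x‖ + ε < (trigPoly d x).re := by
      intro x
      have e1 : ‖(trigPoly d - g) x‖ < ε := ((trigPoly d - g).norm_coe_le_norm x).trans_lt hwg
      have e2 := (abs_le.1 (Complex.abs_re_le_norm ((trigPoly d - g) x))).1
      have e3 : ((trigPoly d - g) x).re = (trigPoly d x).re - (‖trigPoly c x‖ + 2 * ε) := by
        simp [g, g₀]
      rw [e3] at e2
      linarith
    have hd : ‖ContinuousMap.toLp p torusMeasure ℂ (trigPoly d)‖ ≤ N + 3 * ε := by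
      have e1 : trigPoly d = g₀ + ContinuousMap.const _ ((2 * ε : ℝ) : ℂ) + (trigPoly d - g) := by
        simp [g]
      rw [e1, map_add, map_add]
      refine (norm_add₃_le).trans ?_
      have e2 : ‖ContinuousMap.toLp p torusMeasure ℂ g₀‖ ≤ N :=
        rieszAux_norm_mono p _ _ fun x => by simp [g₀]
      have e3 := (rieszAux_norm_le p (ContinuousMap.const Torus ((2 * ε : ℝ) : ℂ)))
      have e4 : ‖ContinuousMap.const Torus ((2 * ε : ℝ) : ℂ)‖ ≤ 2 * ε := by
        rw [ContinuousMap.norm_le _ (by positivity)]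
        intro x
        rw [ContinuousMap.const_apply, Complex.norm_real, Real.norm_of_nonneg (by positivity)]
      have e5 := (rieszAux_norm_le p (trigPoly d - g))
      linarith
    have hd' : ‖ContinuousMap.toLp p torusMeasure ℂ (trigPoly (d - c))‖ ≤ N + 3 * ε + N := by
      rw [map_sub, map_sub]
      exact (norm_sub_le _ _).trans (add_le_add_left hd _)
    have k1 := hAc d fun x => by
      have := hre x
      have := norm_nonneg (trigPoly c x)
      linarith
    have k2 := hAc (d - c) fun x => by
      rw [map_sub, ContinuousMap.sub_apply, sub_re]
      have := hre x
      have := Complex.re_le_norm (trigPoly c x)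
      linarith
    have e : rieszAux_bd c = rieszAux_bd d - rieszAux_bd (d - c) := by
      ext x
      simp [rieszAux_bd, rieszAux_fun_sub]
    rw [e, map_sub]
    refine (norm_sub_le _ _).trans ?_
    nlinarith [mul_le_mul_of_nonneg_left hd hA, mul_le_mul_of_nonneg_left hd' hA]
  apply le_of_forall_pos_le_add
  intro δ hδ
  have := main (δ / (A * 6 + 1)) (by positivity)
  refine this.trans (add_le_add_right ?_ _)
  rw [mul_div_assoc', div_le_iff₀ (by positivity)]
  nlinarith

theorem rieszAux_coeff_zero (p : ℝ≥0∞) [Fact (1 ≤ p)] (c : ℤ →₀ ℂ) :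
    ‖c 0‖ ≤ ‖ContinuousMap.toLp p torusMeasure ℂ (trigPoly c)‖ := by
  have hI : ∀ f : C(Torus, ℂ), Integrable f torusMeasure := fun f =>
    (BoundedContinuousFunction.mkOfCompact f).integrable torusMeasure
  have h0 : ∫ x, trigPoly c x ∂torusMeasure = c 0 := by
    induction c using Finsupp.induction_linear with
    | zero => simp
    | add f g hf hg =>
      rw [map_add]
      simp only [ContinuousMap.add_apply]
      rw [integral_add (hI _) (hI _), hf, hg, Finsupp.add_apply]
    | single n w =>
      rw [trigPoly, Finsupp.linearCombination_single]
      simp only [ContinuousMap.smul_apply]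
      rw [integral_smul]
      have := congrFun (fourierCoeff_fourier (T := 2 * π) n) 0
      rw [fourierCoeff] at this
      simp only [neg_zero, fourier_zero, one_smul] at this
      rw [this, Finsupp.single_apply, Pi.single_apply]
      simp [eq_comm]
  have h1 : ‖c 0‖ ≤ ∫ x, ‖trigPoly c x‖ ∂torusMeasure := by
    rw [← h0]; exact norm_integral_le_integral_norm _
  refine h1.trans ?_
  rw [Lp.norm_def, integral_norm_eq_lintegral_enorm (hI _).1, ← eLpNorm_one_eq_lintegral_enorm,
    eLpNorm_congr_ae (ContinuousMap.coeFn_toLp torusMeasure (trigPoly c))]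
  exact ENNReal.toReal_mono ((trigPoly c).memLp torusMeasure ℂ).eLpNorm_ne_top
    (eLpNorm_le_eLpNorm_of_exponent_le Fact.out (hI _).1)

theorem rieszAux_proj_bound {p : ℝ≥0∞} [Fact (1 ≤ p)] (h1 : 1 < p) (h2 : p ≤ 2) :
    ∃ C : ℝ, ∀ c : ℤ →₀ ℂ,
      ‖ContinuousMap.toLp p torusMeasure ℂ (trigPoly (c.filter (0 ≤ ·)))‖
        ≤ C * ‖ContinuousMap.toLp p torusMeasure ℂ (trigPoly c)‖ := by
  obtain ⟨A, hA, hAc⟩ := rieszAux_bound h1 h2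
  refine ⟨(A + A + 1) / 2, fun c => ?_⟩
  have e : (2 : ℂ) • trigPoly (c.filter (0 ≤ ·)) = rieszAux_bd c - I • rieszAux_bd (I • c)
      + ContinuousMap.const _ (c 0) := by
    ext x
    simpa [rieszAux_bd] using rieszAux_proj c x
  have e2 := congrArg (fun f => ‖ContinuousMap.toLp p torusMeasure ℂ f‖) e
  simp only [map_smul, map_add, map_sub, norm_smul] at e2
  have k1 := hAc c
  have k2 := hAc (I • c)
  rw [map_smul, map_smul, norm_smul, Complex.norm_I, one_mul] at k2
  have k3 := rieszAux_norm_le p (ContinuousMap.const Torus (c 0))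
  have k4 : ‖ContinuousMap.const Torus (c 0)‖ ≤ ‖c 0‖ := by
    rw [ContinuousMap.norm_le _ (by positivity)]; intro x; simp
  have k5 := rieszAux_coeff_zero p c
  have k6 := norm_add_le (ContinuousMap.toLp p torusMeasure ℂ (rieszAux_bd c) -
    I • ContinuousMap.toLp p torusMeasure ℂ (rieszAux_bd (I • c)))
    (ContinuousMap.toLp p torusMeasure ℂ (ContinuousMap.const Torus (c 0)))
  have k7 := norm_sub_le (ContinuousMap.toLp p torusMeasure ℂ (rieszAux_bd c))
    (I • ContinuousMap.toLp p torusMeasure ℂ (rieszAux_bd (I • c)))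
  rw [norm_smul, Complex.norm_I, one_mul] at k7
  rw [← e2] at k6
  simp at k6
  linarith

theorem rieszAux_toLp_trigPoly (p : ℝ≥0∞) [Fact (1 ≤ p)] (c : ℤ →₀ ℂ) :
    ContinuousMap.toLp p torusMeasure ℂ (trigPoly c)
      = Finsupp.linearCombination ℂ (fun n : ℤ => @fourierLp (2 * π) _ p _ n) c := by
  rw [trigPoly, Finsupp.linearCombination_apply, Finsupp.linearCombination_apply, Finsupp.sum,
    Finsupp.sum, map_sum]
  simp

theorem rieszAux_dense (p : ℝ≥0∞) [Fact (1 ≤ p)] (hp : p ≠ ∞) :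
    DenseRange (Finsupp.linearCombination ℂ (fun n : ℤ => @fourierLp (2 * π) _ p _ n)) := by
  have h := span_fourierLp_closure_eq_top (T := 2 * π) hp
  rw [← Finsupp.range_linearCombination] at h
  intro x
  have : x ∈ (⊤ : Submodule ℂ (Lp ℂ p torusMeasure)) := trivial
  rw [← h, ← SetLike.mem_coe, Submodule.topologicalClosure_coe] at this
  exact this

theorem rieszAux_extend {p : ℝ≥0∞} [Fact (1 ≤ p)] (hp : p ≠ ∞) (C : ℝ)
    (hC : ∀ c : ℤ →₀ ℂ,
      ‖ContinuousMap.toLp p torusMeasure ℂ (trigPoly (c.filter (0 ≤ ·)))‖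
        ≤ C * ‖ContinuousMap.toLp p torusMeasure ℂ (trigPoly c)‖) :
    ∃ P : Lp ℂ p torusMeasure →L[ℂ] Lp ℂ p torusMeasure, ∀ n : ℤ,
      P (fourierLp p n) = if 0 ≤ n then fourierLp p n else 0 := by
  let e := Finsupp.linearCombination ℂ (fun n : ℤ => @fourierLp (2 * π) _ p _ n)
  let f := Finsupp.linearCombination ℂ
    (fun n : ℤ => if 0 ≤ n then @fourierLp (2 * π) _ p _ n else 0)
  have hf : ∀ c, f c = e (c.filter (0 ≤ ·)) := by
    intro c
    induction c using Finsupp.induction_linear with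
    | zero => rw [Finsupp.filter_zero]; simp
    | add a b ha hb => rw [Finsupp.filter_add, map_add, map_add, ha, hb]
    | single n w =>
      by_cases hn : 0 ≤ n
      · rw [Finsupp.filter_single_of_pos _ hn]; simp [e, f, hn]
      · rw [Finsupp.filter_single_of_neg _ hn]; simp [f, hn]
  have hb : ∃ C, ∀ c, ‖f c‖ ≤ C * ‖e c‖ := by
    refine ⟨C, fun c => ?_⟩
    rw [hf, ← rieszAux_toLp_trigPoly, ← rieszAux_toLp_trigPoly]
    exact hC c
  refine ⟨f.extendOfNorm e, fun n => ?_⟩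
  have := LinearMap.extendOfNorm_eq (rieszAux_dense p hp) hb (Finsupp.single n 1)
  simpa [e, f] using this

theorem rieszAux_dual {p q : ℝ≥0∞} [Fact (1 ≤ p)] [Fact (1 ≤ q)] [hpq : ENNReal.HolderConjugate p q]
    (hp : p ≠ ∞) (hq : q ≠ ∞) (h2 : 2 ≤ p) (P : Lp ℂ q torusMeasure →L[ℂ] Lp ℂ q torusMeasure)
    (hP : ∀ n : ℤ, P (fourierLp q n) = if 0 ≤ n then fourierLp q n else 0) (c : ℤ →₀ ℂ) :
    ‖ContinuousMap.toLp p torusMeasure ℂ (trigPoly (c.filter (0 ≤ ·)))‖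
        ≤ ‖P‖ * ‖ContinuousMap.toLp p torusMeasure ℂ (trigPoly c)‖ := by
  have h2' : 2 ≤ p.toReal := by
    rw [← ENNReal.toReal_ofNat]; exact (ENNReal.toReal_le_toReal (by simp) hp).2 h2
  have hconj : p.toReal.HolderConjugate q.toReal := hpq.toReal_of_ne_top hp hq
  have hI : ∀ f : C(Torus, ℂ), Integrable f torusMeasure := fun f =>
    (BoundedContinuousFunction.mkOfCompact f).integrable torusMeasure
  let R : Lp ℂ q torusMeasure →ₗᵢ[ℂ] Lp ℂ q torusMeasure :=
    Lp.compMeasurePreservingₗᵢ ℂ (fun x : Torus => -x) (Measure.measurePreserving_neg torusMeasure)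
  have hR : ∀ n : ℤ, R (fourierLp q n) = fourierLp q (-n) := by
    intro n
    apply Lp.ext
    refine (Lp.coeFn_compMeasurePreserving _ (Measure.measurePreserving_neg torusMeasure)).trans ?_
    have := (Measure.measurePreserving_neg torusMeasure).quasiMeasurePreserving.ae_eq_comp
      (coeFn_fourierLp (T := 2 * π) q n)
    refine this.trans ?_
    filter_upwards [coeFn_fourierLp (T := 2 * π) q (-n)] with x hx
    rw [hx]; simp
  let P' : Lp ℂ q torusMeasure →L[ℂ] Lp ℂ q torusMeasure :=
    R.toContinuousLinearMap ∘L P ∘L R.toContinuousLinearMap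
  have hP' : ∀ n : ℤ, P' (fourierLp q n) = if n ≤ 0 then fourierLp q n else 0 := by
    intro n
    simp only [P', ContinuousLinearMap.comp_apply, LinearIsometry.coe_toContinuousLinearMap, hR, hP]
    by_cases hn : n ≤ 0
    · rw [if_pos (by omega), if_pos hn, hR, neg_neg]
    · rw [if_neg (by omega), if_neg hn, map_zero]
  let B := (ContinuousLinearMap.mul ℂ ℂ).lpPairing torusMeasure p q
  have hB : ∀ f g : C(Torus, ℂ), B (ContinuousMap.toLp p torusMeasure ℂ f)
      (ContinuousMap.toLp q torusMeasure ℂ g) = ∫ x, f x * g x ∂torusMeasure := by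
    intro f g
    rw [ContinuousLinearMap.lpPairing_eq_integral]
    apply integral_congr_ae
    filter_upwards [ContinuousMap.coeFn_toLp (p := p) (𝕜 := ℂ) torusMeasure f,
      ContinuousMap.coeFn_toLp (p := q) (𝕜 := ℂ) torusMeasure g] with x h1 h2
    rw [h1, h2]; simp
  have hBf : ∀ n m : ℤ, B (fourierLp p n) (fourierLp q m) = if n = -m then 1 else 0 := by
    intro n m
    refine (hB (fourier n) (fourier m)).trans ?_
    have := congrFun (fourierCoeff_fourier (T := 2 * π) n) (-m)
    rw [fourierCoeff, neg_neg, Pi.single_apply] at this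
    simp only [smul_eq_mul] at this
    simp_rw [mul_comm (fourier n _)]
    rw [this]
    simp [eq_comm]
  have hdual : ∀ (c : ℤ →₀ ℂ) (h : Lp ℂ q torusMeasure),
      B (ContinuousMap.toLp p torusMeasure ℂ (trigPoly (c.filter (0 ≤ ·)))) h
        = B (ContinuousMap.toLp p torusMeasure ℂ (trigPoly c)) (P' h) := by
    intro c h
    rw [rieszAux_toLp_trigPoly, rieszAux_toLp_trigPoly]
    induction c using Finsupp.induction_linear with
    | zero => rw [Finsupp.filter_zero]; simp
    | add a b ha hb =>
      rw [Finsupp.filter_add, map_add, map_add, map_add, map_add, _root_.add_apply,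
        _root_.add_apply, ha, hb]
    | single n w =>
      refine (rieszAux_dense q hq).induction_on (p := fun h => B (Finsupp.linearCombination ℂ
        (fun n : ℤ => @fourierLp (2 * π) _ p _ n) ((Finsupp.single n w).filter (0 ≤ ·))) h =
        B (Finsupp.linearCombination ℂ (fun n : ℤ => @fourierLp (2 * π) _ p _ n)
          (Finsupp.single n w)) (P' h)) h
        (isClosed_eq (by fun_prop) (by fun_prop)) ?_
      intro d
      induction d using Finsupp.induction_linear with
      | zero => simp
      | add a b ha hb => rw [map_add, map_add, map_add, map_add, ha, hb]
      | single m v =>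
        rw [Finsupp.linearCombination_single ℂ v m, map_smul, map_smul, map_smul, hP' m]
        congr 1
        rw [Finsupp.linearCombination_single, map_smul, _root_.smul_apply]
        by_cases hn : 0 ≤ n
        · rw [Finsupp.filter_single_of_pos _ hn, Finsupp.linearCombination_single, map_smul,
            _root_.smul_apply, hBf]
          split_ifs with h1 h2 h2
          · rw [hBf, if_pos h1]
          · omega
          · rw [hBf, if_neg h1]
          · simp
        · rw [Finsupp.filter_single_of_neg _ hn, map_zero, map_zero, _root_.zero_apply]
          split_ifs with h1
          · rw [hBf, if_neg (by omega), smul_zero]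
          · simp
  set f := trigPoly (c.filter (0 ≤ ·)) with hf
  let g : C(Torus, ℂ) := ⟨fun x => conj (f x) * ((‖f x‖ ^ (p.toReal - 2) : ℝ) : ℂ), by
    have : Continuous fun x => ‖f x‖ ^ (p.toReal - 2) :=
      f.continuous.norm.rpow_const fun _ => Or.inr (by linarith)
    fun_prop⟩
  set N := ‖ContinuousMap.toLp p torusMeasure ℂ f‖ with hN
  have hNI : N ^ p.toReal = ∫ x, ‖f x‖ ^ p.toReal ∂torusMeasure := by
    rw [hN, rieszAux_norm p hp, ← Real.rpow_mul (integral_nonneg fun x => by positivity),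
      inv_mul_cancel₀ (by linarith), Real.rpow_one]
  have hfg : ∀ x, f x * g x = ((‖f x‖ ^ p.toReal : ℝ) : ℂ) := by
    intro x
    change f x * (conj (f x) * ((‖f x‖ ^ (p.toReal - 2) : ℝ) : ℂ)) = _
    rw [← mul_assoc, Complex.mul_conj, Complex.normSq_eq_norm_sq, ← Complex.ofReal_mul,
      ← Real.rpow_natCast, ← Real.rpow_add_of_nonneg (norm_nonneg _) (by simp) (by linarith)]
    congr 2; push_cast; ring
  have hgn : ∀ x, ‖g x‖ = ‖f x‖ ^ (p.toReal - 1) := by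
    intro x
    change ‖conj (f x) * ((‖f x‖ ^ (p.toReal - 2) : ℝ) : ℂ)‖ = _
    rw [norm_mul, RCLike.norm_conj, Complex.norm_real, Real.norm_of_nonneg (by positivity)]
    nth_rewrite 1 [← Real.rpow_one ‖f x‖]
    rw [← Real.rpow_add_of_nonneg (norm_nonneg _) (by simp) (by linarith)]
    congr 1; ring
  have hN0 : 0 ≤ N := norm_nonneg _
  have hgN : ‖ContinuousMap.toLp q torusMeasure ℂ g‖ = N ^ (p.toReal - 1) := by
    rw [rieszAux_norm q hq]
    have : ∀ x, ‖g x‖ ^ q.toReal = ‖f x‖ ^ p.toReal := by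
      intro x
      rw [hgn, ← Real.rpow_mul (norm_nonneg _), hconj.sub_one_mul_conj]
    simp_rw [this]
    rw [← hNI, ← Real.rpow_mul hN0]
    congr 1
    rw [← div_eq_mul_inv, hconj.div_conj_eq_sub_one]
  have hpair : B (ContinuousMap.toLp p torusMeasure ℂ f) (ContinuousMap.toLp q torusMeasure ℂ g)
      = ((N ^ p.toReal : ℝ) : ℂ) := by
    rw [hB, hNI]
    simp_rw [hfg]
    exact integral_ofReal
  have hBn : ∀ u v, ‖B u v‖ ≤ ‖u‖ * ‖v‖ := by
    intro u v
    have e1 : B u v = L1.integralCLM' ℂ ((ContinuousLinearMap.mul ℂ ℂ).holder 1 u v) := rfl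
    rw [e1]
    have e2 := (ContinuousLinearMap.mul ℂ ℂ).norm_holder_apply_apply_le (r := 1) u v
    have e3 : ‖ContinuousLinearMap.mul ℂ ℂ‖ ≤ 1 := ContinuousLinearMap.opNorm_mul_le ℂ ℂ
    have e4 : L1.integralCLM' ℂ ((ContinuousLinearMap.mul ℂ ℂ).holder 1 u v)
      = L1.integral ((ContinuousLinearMap.mul ℂ ℂ).holder 1 u v) := (L1.integral_eq' ℂ _).symm
    rw [e4]
    refine (L1.norm_integral_le _).trans (e2.trans ?_)
    rw [mul_assoc]
    exact mul_le_of_le_one_left (by positivity) e3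
  have hP'n : ∀ h, ‖P' h‖ ≤ ‖P‖ * ‖h‖ := by
    intro h
    simp only [P', ContinuousLinearMap.comp_apply, LinearIsometry.coe_toContinuousLinearMap,
      LinearIsometry.norm_map]
    refine (P.le_opNorm _).trans ?_
    rw [LinearIsometry.norm_map]
  have hfin : N ^ p.toReal ≤
      ‖ContinuousMap.toLp p torusMeasure ℂ (trigPoly c)‖ * (‖P‖ * N ^ (p.toReal - 1)) := by
    have : N ^ p.toReal = ‖B (ContinuousMap.toLp p torusMeasure ℂ f)
        (ContinuousMap.toLp q torusMeasure ℂ g)‖ := by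
      rw [hpair, Complex.norm_real, Real.norm_of_nonneg (by positivity)]
    rw [this, hf, hdual]
    refine (hBn _ _).trans (mul_le_mul_of_nonneg_left ?_ (norm_nonneg _))
    rw [← hgN]
    exact hP'n _
  rcases hN0.eq_or_lt with h0 | h0
  · rw [← h0]; positivity
  · have e : N ^ p.toReal = N * N ^ (p.toReal - 1) := by
      nth_rewrite 2 [← Real.rpow_one N]
      rw [← Real.rpow_add h0]; congr 1; ring
    rw [e] at hfin
    have hpos : 0 < N ^ (p.toReal - 1) := Real.rpow_pos_of_pos h0 _
    refine le_of_mul_le_mul_right ?_ hpos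
    linarith

/-- M. Riesz: for `1 < p < ∞` the Riesz projection is bounded on `L^p(𝕋)`. -/
theorem exists_rieszProjection (p : ℝ≥0∞) [Fact (1 ≤ p)] (h1 : 1 < p) (hp : p ≠ ∞) :
    ∃ P : Lp ℂ p torusMeasure →L[ℂ] Lp ℂ p torusMeasure, ∀ n : ℤ,
      P (fourierLp p n) = if 0 ≤ n then fourierLp p n else 0 := by
  have small : ∀ q : ℝ≥0∞, ∀ _ : Fact (1 ≤ q), 1 < q → q ≤ 2 →
      ∃ P : Lp ℂ q torusMeasure →L[ℂ] Lp ℂ q torusMeasure, ∀ n : ℤ,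
        P (fourierLp q n) = if 0 ≤ n then fourierLp q n else 0 := by
    intro q _ hq1 hq2
    obtain ⟨C, hC⟩ := rieszAux_proj_bound hq1 hq2
    exact rieszAux_extend (hq2.trans_lt (by simp)).ne C hC
  rcases le_total p 2 with h2 | h2
  · exact small p inferInstance h1 h2
  · have hpq : ENNReal.HolderConjugate p (ENNReal.conjExponent p) :=
      ENNReal.HolderConjugate.conjExponent Fact.out
    set q := ENNReal.conjExponent p with hq
    have hq' : q = 1 + (p - 1)⁻¹ := rfl
    have hq1 : 1 < q := by
      rw [hq']
      apply ENNReal.lt_add_right (by simp)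
      simp [hp]
    have hq2 : q ≤ 2 := by
      rw [hq', ← one_add_one_eq_two]
      gcongr
      rw [ENNReal.inv_le_one]
      rw [← one_add_one_eq_two] at h2
      exact ENNReal.le_sub_of_add_le_left (by simp) h2
    have : Fact (1 ≤ q) := ⟨hq1.le⟩
    obtain ⟨P, hP⟩ := small q inferInstance hq1 hq2
    exact rieszAux_extend hp ‖P‖ (rieszAux_dual hp (hq2.trans_lt (by simp)).ne h2 P hP)

/-! ### Function spaces on the unit circle -/

theorem neg_measurePreserving :
    MeasurePreserving (fun x : Torus => -x) torusMeasure torusMeasure :=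
  Measure.measurePreserving_neg torusMeasure

instance (p : ℝ≥0∞) [h : Fact (1 < p)] : Fact (1 ≤ p) := ⟨h.out.le⟩

/-- Classes of measurable functions on `𝕋` form a commutative ring with the pointwise
operations. -/
noncomputable instance : CommRing (Torus →ₘ[torusMeasure] ℂ) :=
  { (inferInstance : AddCommGroup (Torus →ₘ[torusMeasure] ℂ)),
    (inferInstance : CommMonoid (Torus →ₘ[torusMeasure] ℂ)) with
    left_distrib := fun a b c => by
      induction a using AEEqFun.induction_on with | _ f hf
      induction b using AEEqFun.induction_on with | _ g hg
      induction c using AEEqFun.induction_on with | _ h hh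
      simp only [AEEqFun.mk_add_mk, AEEqFun.mk_mul_mk, mul_add]
    right_distrib := fun a b c => by
      induction a using AEEqFun.induction_on with | _ f hf
      induction b using AEEqFun.induction_on with | _ g hg
      induction c using AEEqFun.induction_on with | _ h hh
      simp only [AEEqFun.mk_add_mk, AEEqFun.mk_mul_mk, add_mul]
    zero_mul := fun a => by
      induction a using AEEqFun.induction_on with | _ f hf
      rw [AEEqFun.zero_def, AEEqFun.mk_mul_mk]
      congr 1
      exact zero_mul f
    mul_zero := fun a => by
      induction a using AEEqFun.induction_on with | _ f hf
      rw [AEEqFun.zero_def, AEEqFun.mk_mul_mk]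
      congr 1
      exact mul_zero f }

/-- The ring `L^∞(𝕋)` of (classes of) essentially bounded measurable functions with the
pointwise operations; its units are the functions that are invertible in `L^∞(𝕋)`. -/
noncomputable def Linf : Subring (Torus →ₘ[torusMeasure] ℂ) where
  __ := (Lp ℂ ∞ torusMeasure : AddSubgroup (Torus →ₘ[torusMeasure] ℂ))
  mul_mem' := by
    intro f g hf hg
    change f ∈ Lp ℂ ∞ torusMeasure at hf
    change g ∈ Lp ℂ ∞ torusMeasure at hg
    change f * g ∈ Lp ℂ ∞ torusMeasure
    rw [Lp.mem_Lp_iff_memLp] at *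
    exact (memLp_congr_ae (AEEqFun.coeFn_mul f g)).2 (hg.mul hf)
  one_mem' := by
    change (1 : Torus →ₘ[torusMeasure] ℂ) ∈ Lp ℂ ∞ torusMeasure
    rw [Lp.mem_Lp_iff_memLp]
    exact (memLp_congr_ae AEEqFun.coeFn_one).2 (memLp_top_const 1)

/-- The operation `a ↦ ã`, `ã(t) = a(1/t)`, on `L^∞(𝕋)`. -/
noncomputable def tilde : Linf →+* Linf where
  toFun a := ⟨a.1.compMeasurePreserving _ neg_measurePreserving,
    AEEqFun.compMeasurePreserving_mem_Lp a.2 neg_measurePreserving⟩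
  map_one' := rfl
  map_zero' := rfl
  map_mul' := by
    rintro ⟨a, ha⟩ ⟨b, hb⟩
    apply Subtype.ext
    induction a using AEEqFun.induction_on
    induction b using AEEqFun.induction_on
    rfl
  map_add' := by
    rintro ⟨a, ha⟩ ⟨b, hb⟩
    apply Subtype.ext
    induction a using AEEqFun.induction_on
    induction b using AEEqFun.induction_on
    rfl

section Operators

variable (p : ℝ≥0∞) [Fact (1 < p)]

/-- The operator of multiplication by `a ∈ L^∞(𝕋)` on `L^p(𝕋)`. -/
noncomputable def mulOp (a : Linf) : Lp ℂ p torusMeasure →L[ℂ] Lp ℂ p torusMeasure :=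
  (ContinuousLinearMap.mul ℂ ℂ).holderL torusMeasure ∞ p p ⟨a.1, a.2⟩

/-- The function `t ↦ t̄ = t⁻¹` as an element of `L^∞(𝕋)`. -/
noncomputable def conjVar : Linf :=
  ⟨(fourierLp ∞ (-1) : Lp ℂ ∞ torusMeasure).1, (fourierLp ∞ (-1) : Lp ℂ ∞ torusMeasure).2⟩

/-- The flip operator `(Jf)(t) = t̄ f(t̄)` on `L^p(𝕋)`. -/
noncomputable def flipOp : Lp ℂ p torusMeasure →L[ℂ] Lp ℂ p torusMeasure :=
  mulOp p conjVar ∘L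
    (Lp.compMeasurePreservingₗᵢ ℂ (fun x : Torus => -x)
      neg_measurePreserving).toContinuousLinearMap

/-- The Hardy space `H^p`: all `f ∈ L^p(𝕋)` whose Fourier coefficients with negative index
vanish. -/
def Hp : Submodule ℂ (Lp ℂ p torusMeasure) where
  carrier := {f | ∀ n : ℤ, n < 0 → fourierCoeff f n = 0}
  zero_mem' := by
    intro n _
    rw [fourierCoeff_congr_ae (Lp.coeFn_zero ℂ p torusMeasure)]
    simp [fourierCoeff]
  add_mem' := by
    intro f g hf hg n hn
    have hi : ∀ f : Lp ℂ p torusMeasure, Integrable f torusMeasure := fun f =>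
      (Lp.memLp f).integrable Fact.out
    rw [fourierCoeff_congr_ae (Lp.coeFn_add f g), fourierCoeff.add (hi f) (hi g), Pi.add_apply,
      hf n hn, hg n hn, add_zero]
  smul_mem' := by
    intro c f hf n hn
    rw [fourierCoeff_congr_ae (Lp.coeFn_smul c f)]
    have := fourierCoeff.const_smul (f : Torus → ℂ) c n
    rw [hf n hn, smul_zero] at this
    exact this

theorem mem_Hp_iff (f : Lp ℂ p torusMeasure) :
    f ∈ Hp p ↔ ∀ n : ℤ, n < 0 → fourierCoeff f n = 0 := Iff.rfl

theorem isClosed_Hp : IsClosed (Hp p : Set (Lp ℂ p torusMeasure)) := by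
  have hi : ∀ f : Lp ℂ p torusMeasure, Integrable f torusMeasure := fun f =>
    (Lp.memLp f).integrable Fact.out
  have hc : ∀ n : ℤ, Continuous fun f : Lp ℂ p torusMeasure => fourierCoeff f n := by
    intro n
    refine LipschitzWith.continuous (K := 1) (LipschitzWith.of_dist_le_mul fun f g => ?_)
    have e : fourierCoeff f n - fourierCoeff g n
        = ∫ x, (fourier (-n) x : ℂ) • (f - g : Lp ℂ p torusMeasure) x ∂torusMeasure := by
      rw [fourierCoeff, fourierCoeff, ← integral_sub ((hi f).fourier_smul _)
        ((hi g).fourier_smul _)]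
      apply integral_congr_ae
      filter_upwards [Lp.coeFn_sub f g] with x hx
      rw [hx, Pi.sub_apply, smul_sub]
    rw [dist_eq_norm, dist_eq_norm, e, NNReal.coe_one, one_mul]
    refine (norm_integral_le_integral_norm _).trans ?_
    have e2 : ∀ x : Torus, ‖(fourier (-n) x : ℂ) • (f - g : Lp ℂ p torusMeasure) x‖
        = ‖(f - g : Lp ℂ p torusMeasure) x‖ := by
      intro x
      rw [norm_smul, fourier_apply, Circle.norm_coe, one_mul]
    simp_rw [e2]
    rw [Lp.norm_def, integral_norm_eq_lintegral_enorm (hi _).1, ← eLpNorm_one_eq_lintegral_enorm]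
    exact ENNReal.toReal_mono (Lp.memLp _).eLpNorm_ne_top
      (eLpNorm_le_eLpNorm_of_exponent_le Fact.out (hi _).1)
  have : (Hp p : Set (Lp ℂ p torusMeasure))
      = ⋂ n : ℤ, ⋂ _ : n < 0, {f : Lp ℂ p torusMeasure | fourierCoeff f n = 0} := by
    ext f; simp [mem_Hp_iff]
  rw [this]
  exact isClosed_iInter fun n => isClosed_iInter fun _ => isClosed_eq (hc n) continuous_const

variable [Fact (p ≠ ∞)]

/-- The Riesz projection `P : L^p(𝕋) → L^p(𝕋)`, `∑ fₙ e^{inθ} ↦ ∑_{n ≥ 0} fₙ e^{inθ}`, i.e. the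
(unique) bounded operator with `P e^{inθ} = e^{inθ}` for `n ≥ 0` and `P e^{inθ} = 0` for
`n < 0`. -/
noncomputable def rieszProjection : Lp ℂ p torusMeasure →L[ℂ] Lp ℂ p torusMeasure :=
  (exists_rieszProjection p Fact.out Fact.out).choose

theorem rieszProjection_fourierLp (n : ℤ) :
    rieszProjection p (fourierLp p n) = if 0 ≤ n then fourierLp p n else 0 :=
  (exists_rieszProjection p Fact.out Fact.out).choose_spec n

theorem rieszProjection_unique (P : Lp ℂ p torusMeasure →L[ℂ] Lp ℂ p torusMeasure)
    (hP : ∀ n : ℤ, P (fourierLp p n) = if 0 ≤ n then fourierLp p n else 0) :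
    P = rieszProjection p := by
  refine ContinuousLinearMap.ext_on (s := range (@fourierLp (2 * π) _ p _)) ?_ ?_
  · rw [Submodule.dense_iff_topologicalClosure_eq_top]
    exact span_fourierLp_closure_eq_top Fact.out
  · rintro _ ⟨n, rfl⟩
    rw [hP, rieszProjection_fourierLp]

theorem rieszProjection_mem (f : Lp ℂ p torusMeasure) : rieszProjection p f ∈ Hp p := by
  refine (rieszAux_dense p Fact.out).induction_on (p := fun f => rieszProjection p f ∈ Hp p) f
    ((isClosed_Hp p).preimage (rieszProjection p).continuous) fun c => ?_
  rw [Finsupp.linearCombination_apply, Finsupp.sum, map_sum]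
  refine sum_mem fun n _ => ?_
  rw [map_smul, rieszProjection_fourierLp]
  refine Submodule.smul_mem _ _ ?_
  split_ifs with h
  · intro m hm
    rw [fourierCoeff_congr_ae (coeFn_fourierLp p n), fourierCoeff_fourier,
      Pi.single_eq_of_ne (by omega)]
  · exact zero_mem _

/-- The Toeplitz operator `T(a) : H^p → H^p`, `f ↦ P a f`. -/
noncomputable def toeplitz (a : Linf) : Hp p →L[ℂ] Hp p :=
  (rieszProjection p ∘L mulOp p a ∘L (Hp p).subtypeL).codRestrict (Hp p)
    fun _ => rieszProjection_mem p _

/-- The Hankel operator `H(b) : H^p → H^p`, `f ↦ P b Q J f` with `Q = I - P`. -/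
noncomputable def hankel (b : Linf) : Hp p →L[ℂ] Hp p :=
  (rieszProjection p ∘L mulOp p b ∘L (ContinuousLinearMap.id ℂ _ - rieszProjection p) ∘L
    flipOp p ∘L (Hp p).subtypeL).codRestrict (Hp p) fun _ => rieszProjection_mem p _

/-- The operator `diag(T(a) + H(b), T(a) - H(b))` on `H^p × H^p`. -/
noncomputable def diagToeplitzHankel (a b : Linf) : (Hp p × Hp p) →L[ℂ] (Hp p × Hp p) :=
  (toeplitz p a + hankel p b).prodMap (toeplitz p a - hankel p b)

/-- The block Toeplitz operator on `H^p × H^p` generated by a `2 × 2` matrix function `U`: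
`(f, g) ↦ (T(U₁₁) f + T(U₁₂) g, T(U₂₁) f + T(U₂₂) g)`. -/
noncomputable def blockToeplitz (U : Matrix (Fin 2) (Fin 2) Linf) :
    (Hp p × Hp p) →L[ℂ] (Hp p × Hp p) :=
  ((toeplitz p (U 0 0)).coprod (toeplitz p (U 0 1))).prod
    ((toeplitz p (U 1 0)).coprod (toeplitz p (U 1 1)))

end Operators

/-- The matrix function `U(a, b)` for `a` invertible in `L^∞(𝕋)` and `b ∈ L^∞(𝕋)`. -/
noncomputable def matrixU (a : Linfˣ) (b : Linf) : Matrix (Fin 2) (Fin 2) Linf :=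
  let ainv : Linf := ((Units.map (tilde : Linf →* Linf) a)⁻¹ : Linfˣ)
  !![(a : Linf) - b * tilde b * ainv, -(b * ainv);
     tilde b * ainv,                  ainv]

section Fredholm

variable {X : Type*} [NormedAddCommGroup X] [NormedSpace ℂ X]

/-- The cokernel of `A` : the null space of the adjoint operator `A^* : X^* → X^*`, `h ↦ h ∘ A`. -/
noncomputable def coker (A : X →L[ℂ] X) : Submodule ℂ (StrongDual ℂ X) :=
  (ContinuousLinearMap.precomp ℂ A).ker

/-- The index `dim ker A - dim coker A` of a Fredholm operator `A`. -/
noncomputable def index (A : X →L[ℂ] X) : ℤ :=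
  (Module.finrank ℂ A.ker : ℤ) - (Module.finrank ℂ (coker A) : ℤ)

end Fredholm

end ToeplitzHankel

/-!
Write `P` for the Riesz projection, `Q = 1 - P`, and let `P` and `Q` also act componentwise on
`L^p × L^p`. Both operators of the theorem are compressions to `H^p × H^p`: since `J` maps `H^p`
into the range of `Q`, the operator `diag(T(a) + H(b), T(a) - H(b))` is the compression of
`diag(a + b J, a - b J)` (`compress_diagMulFlip`), while `T(U)` is the compression of the
multiplication by `U` (`compress_blockMul`).

The compression of an operator `A` to the range of a projection `P` and the operator `A P + Q` on
the whole space determine each other's kernel and cokernel, and they are Fredholm at the same time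
(`kerPairedEquiv`, `cokerPairedEquiv`, `isFredholm_paired_iff`), because
`A P + Q = (1 + Q A P) (P A P + Q)` with an invertible first factor. It therefore suffices to relate
the operators `diag(a + b J, a - b J) P + Q` and `U(a, b) P + Q` by invertible factors. Here the
relations `J² = 1`, `J P J = Q` and `J f J = f̃` enter. With the invertible operator
`S (u, v) = (u + v, J (u - v))` they give
`S (diag(a + b J, a - b J) P + Q) S⁻¹ = M P + N Q`, where the matrix function `M` has the rows
`(a, 0)` and `(b̃, 1)`, and `N` has the rows `(1, b)` and `(0, ã)`. As `a` is invertible, so is `N`,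
and `N⁻¹ M = U(a, b)`. This is `triangularMul_flipMix_paired`.

That `P` is the identity on `H^p` rests on the fact that a function in `L^p(𝕋)` is determined by
its Fourier coefficients (`eq_zero_of_fourierCoeff_eq_zero`).
-/

namespace ToeplitzHankel

open MeasureTheory Complex Set
open scoped ENNReal Real

/-! ### Multiplication operators and the flip -/

section RieszProjection

variable (p : ℝ≥0∞) [Fact (1 < p)]

theorem coeFn_mulOp (a : Linf) (f : Lp ℂ p torusMeasure) :
    mulOp p a f =ᵐ[torusMeasure] fun x => a.1 x * f x :=
  (ContinuousLinearMap.mul ℂ ℂ).coeFn_holder (r := p) (⟨a.1, a.2⟩ : Lp ℂ ∞ torusMeasure) f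

theorem mulOp_one (f : Lp ℂ p torusMeasure) : mulOp p 1 f = f := by
  apply Lp.ext
  filter_upwards [coeFn_mulOp p 1 f, AEEqFun.coeFn_one (μ := torusMeasure) (α := Torus) (β := ℂ)]
    with x h1 h2
  rw [h1]
  change (1 : Torus →ₘ[torusMeasure] ℂ) x * f x = f x
  rw [h2, Pi.one_apply, one_mul]

theorem mulOp_mul (a b : Linf) (f : Lp ℂ p torusMeasure) :
    mulOp p (a * b) f = mulOp p a (mulOp p b f) := by
  apply Lp.ext
  filter_upwards [coeFn_mulOp p (a * b) f, coeFn_mulOp p a (mulOp p b f), coeFn_mulOp p b f,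
    AEEqFun.coeFn_mul a.1 b.1] with x h1 h2 h3 h4
  rw [h1, h2, h3, ← mul_assoc]
  exact congrArg (· * f x) h4

theorem mulOp_sub (a b : Linf) (f : Lp ℂ p torusMeasure) :
    mulOp p (a - b) f = mulOp p a f - mulOp p b f := by
  apply Lp.ext
  filter_upwards [coeFn_mulOp p (a - b) f, coeFn_mulOp p a f, coeFn_mulOp p b f,
    AEEqFun.coeFn_sub a.1 b.1, Lp.coeFn_sub (mulOp p a f) (mulOp p b f)] with x h1 h2 h3 h4 h5
  rw [h1, h5, Pi.sub_apply, h2, h3, ← sub_mul]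
  exact congrArg (· * f x) h4

theorem mulOp_neg (a : Linf) (f : Lp ℂ p torusMeasure) : mulOp p (-a) f = -mulOp p a f := by
  have h0 := mulOp_sub p 0 a f
  have h1 := mulOp_sub p 0 0 f
  rw [sub_self, sub_self] at h1
  rwa [h1, zero_sub, zero_sub] at h0

theorem coeFn_tilde (a : Linf) : (tilde a).1 =ᵐ[torusMeasure] fun x => a.1 (-x) :=
  AEEqFun.coeFn_compMeasurePreserving a.1 neg_measurePreserving

theorem coeFn_conjVar : conjVar.1 =ᵐ[torusMeasure] fun x => fourier (-1) x :=
  coeFn_fourierLp ∞ (-1)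

theorem coeFn_flipOp (f : Lp ℂ p torusMeasure) :
    flipOp p f =ᵐ[torusMeasure] fun x => fourier (-1) x * f (-x) := by
  filter_upwards [coeFn_mulOp p conjVar (Lp.compMeasurePreserving _ neg_measurePreserving f),
    coeFn_conjVar, Lp.coeFn_compMeasurePreserving f neg_measurePreserving] with x h1 h2 h3
  rw [h2, h3] at h1
  exact h1

theorem flipOp_flipOp (f : Lp ℂ p torusMeasure) : flipOp p (flipOp p f) = f := by
  apply Lp.ext
  filter_upwards [coeFn_flipOp p (flipOp p f),
    neg_measurePreserving.quasiMeasurePreserving.ae_eq_comp (coeFn_flipOp p f)] with x h1 h2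
  rw [h1]
  simp only [Function.comp_apply] at h2
  rw [h2, neg_neg, ← mul_assoc]
  have : (fourier (-1) x : ℂ) * fourier (-1) (-x) = 1 := by
    have e : (fourier (-1) (-x) : ℂ) = fourier 1 x := by simp [fourier_apply]
    rw [e, ← fourier_add]; simp
  rw [this, one_mul]

theorem flipOp_mulOp (a : Linf) (f : Lp ℂ p torusMeasure) :
    flipOp p (mulOp p a f) = mulOp p (tilde a) (flipOp p f) := by
  apply Lp.ext
  filter_upwards [coeFn_flipOp p (mulOp p a f), coeFn_mulOp p (tilde a) (flipOp p f),
    coeFn_flipOp p f, coeFn_tilde a,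
    neg_measurePreserving.quasiMeasurePreserving.ae_eq_comp (coeFn_mulOp p a f)]
    with x h1 h2 h3 h4 h5
  simp only [Function.comp_apply] at h5
  rw [h1, h2, h3, h4, h5]
  ring

theorem flipOp_fourierLp (n : ℤ) : flipOp p (fourierLp p n) = fourierLp p (-n - 1) := by
  apply Lp.ext
  filter_upwards [coeFn_flipOp p (fourierLp p n), coeFn_fourierLp (T := 2 * π) p (-n - 1),
    neg_measurePreserving.quasiMeasurePreserving.ae_eq_comp (coeFn_fourierLp (T := 2 * π) p n)]
    with x h1 h2 h3
  simp only [Function.comp_apply] at h3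
  rw [h1, h2, h3]
  have e : (fourier n (-x) : ℂ) = fourier (-n) x := by simp [fourier_apply]
  rw [e, ← fourier_add]
  congr 1
  ring_nf

/-! ### The Riesz projection is a projection onto the Hardy space -/

instance : Fact (p.conjExponent ≠ ∞) := by
  have : 1 < p := Fact.out
  exact ⟨by simp [ENNReal.conjExponent, tsub_eq_zero_iff_le, this]⟩

variable [Fact (p ≠ ∞)]

/-- Bounded operators on `L^p(𝕋)` are determined by their values on the functions `tⁿ`. -/
theorem clm_ext_fourierLp {F : Type*} [NormedAddCommGroup F] [NormedSpace ℂ F]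
    {A B : Lp ℂ p torusMeasure →L[ℂ] F} (h : ∀ n : ℤ, A (fourierLp p n) = B (fourierLp p n)) :
    A = B := by
  refine ContinuousLinearMap.ext_on (s := range (@fourierLp (2 * π) _ p _)) ?_ ?_
  · rw [Submodule.dense_iff_topologicalClosure_eq_top]
    exact span_fourierLp_closure_eq_top Fact.out
  · rintro _ ⟨n, rfl⟩
    exact h n

theorem rieszProjection_flipOp (f : Lp ℂ p torusMeasure) :
    rieszProjection p (flipOp p f) = flipOp p f - flipOp p (rieszProjection p f) := by
  have : rieszProjection p ∘L flipOp p = flipOp p - flipOp p ∘L rieszProjection p := by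
    refine clm_ext_fourierLp p fun n => ?_
    simp only [ContinuousLinearMap.comp_apply, _root_.sub_apply, flipOp_fourierLp,
      rieszProjection_fourierLp]
    by_cases h : 0 ≤ n
    · rw [if_neg (by omega), if_pos h, flipOp_fourierLp, sub_self]
    · rw [if_pos (by omega), if_neg h, map_zero, sub_zero]
  exact DFunLike.congr_fun this f

instance : Fact (1 < p.conjExponent) := by
  refine ⟨ENNReal.lt_add_right (by simp) ?_⟩
  have : p ≠ ∞ := Fact.out
  simp [this]

theorem fourierCoeff_eq_lpPairing (f : Lp ℂ p torusMeasure) (n : ℤ) :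
    fourierCoeff f n = (ContinuousLinearMap.mul ℂ ℂ).lpPairing torusMeasure p p.conjExponent f
      (fourierLp p.conjExponent (-n)) := by
  rw [ContinuousLinearMap.lpPairing_eq_integral, fourierCoeff]
  apply integral_congr_ae
  filter_upwards [coeFn_fourierLp (T := 2 * π) p.conjExponent (-n)] with x hx
  rw [hx, ContinuousLinearMap.mul_apply', smul_eq_mul, mul_comm]

/-- The conjugate exponent is finite, so trigonometric polynomials are dense in `L^q(𝕋)`, and a
function all of whose Fourier coefficients vanish is annihilated by the whole of `L^q(𝕋)`, in
particular by all indicator functions. -/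
theorem eq_zero_of_fourierCoeff_eq_zero {f : Lp ℂ p torusMeasure}
    (hf : ∀ n : ℤ, fourierCoeff f n = 0) : f = 0 := by
  set B := (ContinuousLinearMap.mul ℂ ℂ).lpPairing torusMeasure p p.conjExponent f with hB
  have hB0 : B = 0 := clm_ext_fourierLp _ fun n => by
    have := hf (-n)
    rw [fourierCoeff_eq_lpPairing, neg_neg] at this
    exact this
  have hp : (1 : ℝ≥0∞) < p := Fact.out
  have hint : Integrable f torusMeasure := (Lp.memLp f).integrable hp.le
  refine (Lp.eq_zero_iff_ae_eq_zero).2 (Lp.ae_eq_zero_of_forall_setIntegral_eq_zero f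
    (zero_lt_one.trans hp).ne' Fact.out (fun s _ _ => hint.integrableOn) fun s hs hμ => ?_)
  have h := DFunLike.congr_fun hB0 (indicatorConstLp p.conjExponent hs hμ.ne (1 : ℂ))
  rw [hB, ContinuousLinearMap.lpPairing_eq_integral, _root_.zero_apply] at h
  rw [← h, ← integral_indicator hs]
  apply integral_congr_ae
  filter_upwards [indicatorConstLp_coeFn (p := p.conjExponent) (hs := hs) (hμs := hμ.ne)
    (c := (1 : ℂ))] with x hx
  rw [hx, ContinuousLinearMap.mul_apply']
  by_cases h : x ∈ s <;> simp [h]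

theorem fourierCoeff_rieszProjection (f : Lp ℂ p torusMeasure) {n : ℤ} (hn : 0 ≤ n) :
    fourierCoeff (rieszProjection p f) n = fourierCoeff f n := by
  let B := ((ContinuousLinearMap.mul ℂ ℂ).lpPairing torusMeasure p p.conjExponent).flip
      (fourierLp p.conjExponent (-n))
  have key : B ∘L rieszProjection p = B := by
    refine clm_ext_fourierLp p fun m => ?_
    rw [ContinuousLinearMap.comp_apply, rieszProjection_fourierLp]
    split_ifs with hm
    · rfl
    · rw [map_zero, eq_comm]
      change (ContinuousLinearMap.mul ℂ ℂ).lpPairing torusMeasure p p.conjExponent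
        (fourierLp p m) (fourierLp p.conjExponent (-n)) = 0
      rw [← fourierCoeff_eq_lpPairing, fourierCoeff_congr_ae (coeFn_fourierLp p m),
        fourierCoeff_fourier, Pi.single_eq_of_ne (by omega)]
  rw [fourierCoeff_eq_lpPairing, fourierCoeff_eq_lpPairing]
  exact DFunLike.congr_fun key f

theorem rieszProjection_of_mem {f : Lp ℂ p torusMeasure} (hf : f ∈ Hp p) :
    rieszProjection p f = f := by
  have hsub : rieszProjection p f - f ∈ Hp p := sub_mem (rieszProjection_mem p f) hf
  refine sub_eq_zero.1 (eq_zero_of_fourierCoeff_eq_zero p fun n => ?_)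
  rcases lt_or_ge n 0 with hn | hn
  · exact hsub n hn
  · rw [fourierCoeff_eq_lpPairing, map_sub, _root_.sub_apply, ← fourierCoeff_eq_lpPairing,
      ← fourierCoeff_eq_lpPairing, fourierCoeff_rieszProjection p f hn, sub_self]

end RieszProjection

/-! ### Compressions of an operator to a complemented subspace -/

section Compression

open LinearMap LinearMap.FiniteRangeSetoid

variable {X Y : Type*} [NormedAddCommGroup X] [NormedSpace ℂ X]
  [NormedAddCommGroup Y] [NormedSpace ℂ Y]

/-- For `i : X → Y` with left inverse `r` and the projection `Π = i r` of `Y`, the operator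
`A Π + (1 - Π)` on `Y`. The space `X` plays the role of the range of `Π`. -/
noncomputable def paired (i : X →L[ℂ] Y) (r : Y →L[ℂ] X) (A : Y →L[ℂ] Y) : Y →L[ℂ] Y :=
  A ∘L i ∘L r + (ContinuousLinearMap.id ℂ Y - i ∘L r)

variable {i : X →L[ℂ] Y} {r : Y →L[ℂ] X}

theorem paired_apply (A : Y →L[ℂ] Y) (y : Y) : paired i r A y = A (i (r y)) + (y - i (r y)) := rfl

/-- If `y` is in the kernel of `A Π + (1 - Π)`, then `r y` is in the kernel of `r A i`; conversely
a vector `x` of the latter kernel comes from `y = i x - A i x` only. -/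
noncomputable def kerPairedEquiv (hri : ∀ x, r (i x) = x) (A : Y →L[ℂ] Y) :
    (paired i r A).ker ≃ₗ[ℂ] (r ∘L A ∘L i).ker where
  toFun y := ⟨r y, by
    have h : A (i (r y)) + (y - i (r y)) = 0 := y.2
    have h2 := congrArg r h
    rw [map_add, map_sub, hri, sub_self, add_zero, map_zero] at h2
    exact h2⟩
  map_add' y z := Subtype.ext (map_add r y.1 z.1)
  map_smul' c y := Subtype.ext (map_smul r c y.1)
  invFun x := ⟨i x - A (i x), by
    have h : r (A (i x)) = 0 := x.2
    change A (i (r (i x - A (i x)))) + (i x - A (i x) - i (r (i x - A (i x)))) = 0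
    rw [map_sub r, hri, h, sub_zero]
    abel⟩
  left_inv y := by
    have h : A (i (r y)) + (y - i (r y)) = 0 := y.2
    ext
    change i (r y) - A (i (r y)) = y
    rw [eq_comm, ← sub_eq_zero, ← h]
    abel
  right_inv x := by
    have h : r (A (i x)) = 0 := x.2
    ext
    change r (i x - A (i x)) = x
    rw [map_sub, hri, h, sub_zero]

theorem mem_coker {A : Y →L[ℂ] Y} {h : StrongDual ℂ Y} : h ∈ coker A ↔ ∀ y, h (A y) = 0 :=
  DFunLike.ext_iff

/-- A functional that annihilates the range of `A Π + (1 - Π)` vanishes on the range of `1 - Π`,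
and is thus determined by its restriction to the range of `Π`. -/
noncomputable def cokerPairedEquiv (hri : ∀ x, r (i x) = x) (A : Y →L[ℂ] Y) :
    coker (paired i r A) ≃ₗ[ℂ] coker (r ∘L A ∘L i) := by
  have key : ∀ h ∈ coker (paired i r A), ∀ y, h (i (r y)) = h y := by
    intro h hh y
    have := mem_coker.1 hh (y - i (r y))
    rw [paired_apply, map_sub r, hri, sub_self, map_zero, map_zero, sub_zero, zero_add,
      map_sub, sub_eq_zero] at this
    exact this.symm
  exact
  { toFun := fun h => ⟨h.1 ∘L i, mem_coker.2 fun x => by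
      have h1 := mem_coker.1 h.2 (i x)
      rw [paired_apply, hri, sub_self, add_zero] at h1
      change h.1 (i (r (A (i x)))) = 0
      rw [key h.1 h.2, h1]⟩
    map_add' := fun g h => rfl
    map_smul' := fun c h => rfl
    invFun := fun g => ⟨g.1 ∘L r, mem_coker.2 fun y => by
      have h1 : g.1 (r (A (i (r y)))) = 0 := mem_coker.1 g.2 (r y)
      change g.1 (r (A (i (r y)) + (y - i (r y)))) = 0
      rw [map_add, map_sub r, hri, sub_self, add_zero, h1]⟩
    left_inv := fun h => by
      ext y
      exact key h.1 h.2 y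
    right_inv := fun g => by
      ext x
      exact congrArg g.1 (hri x) }

/-- If `K - 1` has finite rank and `T - 1` factors through `K - 1`, then `T - 1` has finite rank. -/
theorem equiv_id_of_sub_eq {V W : Type*} [AddCommGroup V] [Module ℂ V] [AddCommGroup W]
    [Module ℂ W]
    {K : V →ₗ[ℂ] V} (hK : K ≈ LinearMap.id) {T : W →ₗ[ℂ] W} (b : V →ₗ[ℂ] W) (c : W →ₗ[ℂ] V)
    (h : ∀ w, T w - w = b (K (c w) - c w)) : T ≈ LinearMap.id := by
  have e : T - LinearMap.id = (b ∘ₗ (K - LinearMap.id)) ∘ₗ c := LinearMap.ext h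
  rw [equiv_iff_hasNoetherianRange] at hK ⊢
  rw [e]
  exact (hK.comp_left b).comp_right c

/-- A quasi-inverse of either operator yields one of the other by an explicit formula. -/
theorem isFredholm_paired_iff (hri : ∀ x, r (i x) = x) (A : Y →L[ℂ] Y) :
    (paired i r A).IsFredholm ↔ (r ∘L A ∘L i).IsFredholm := by
  constructor
  · intro h
    obtain ⟨S, hS1, hS2⟩ := h.exists_isQuasiInverse
    refine .of_isQuasiInverse (v := r ∘L S ∘L i) ⟨?_, ?_⟩
    · -- `r S i r A i - 1 = r (S C - 1) (i - (1 - Π) A i)` for `C = A Π + (1 - Π)`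
      refine equiv_id_of_sub_eq hS1 r (i - (A ∘L i - i ∘L r ∘L A ∘L i) : X →L[ℂ] Y) fun x => ?_
      simp [paired_apply, hri]
    · -- `r A i r S i - 1 = r (C S - 1) i`
      refine equiv_id_of_sub_eq hS2 r i fun x => ?_
      simp [paired_apply, hri]
  · intro h
    obtain ⟨S, hS1, hS2⟩ := h.exists_isQuasiInverse
    -- `A Π + 1 - Π` is the product of `1 + (1 - Π) A Π`, with inverse `1 - (1 - Π) A Π`, and of
    -- `Π A Π + 1 - Π`, with quasi-inverse `i S r + 1 - Π`
    refine .of_isQuasiInverse (v := (ContinuousLinearMap.id ℂ Y - (A ∘L i ∘L r -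
      i ∘L r ∘L A ∘L i ∘L r)) ∘L (i ∘L S ∘L r + (ContinuousLinearMap.id ℂ Y - i ∘L r))) ⟨?_, ?_⟩
    · refine equiv_id_of_sub_eq hS1 (i - (A ∘L i - i ∘L r ∘L A ∘L i) : X →L[ℂ] Y) r fun y => ?_
      simp [paired_apply, hri]
      abel
    · refine equiv_id_of_sub_eq hS2 i r fun y => ?_
      simp [paired_apply, hri]
      abel

end Compression

/-! ### Equivalent operators -/

section Equivalence

open LinearMap LinearMap.FiniteRangeSetoid

variable {Y : Type*} [NormedAddCommGroup Y] [NormedSpace ℂ Y] {C D : Y →L[ℂ] Y} {G E : Y ≃L[ℂ] Y}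

theorem isFredholm_of_intertwine (h : ∀ y, G (C y) = D (E y)) (hD : D.IsFredholm) :
    C.IsFredholm := by
  obtain ⟨S, hS1, hS2⟩ := hD.exists_isQuasiInverse
  refine .of_isQuasiInverse
    (v := (E.symm : Y →L[ℂ] Y) ∘L S ∘L (G : Y →L[ℂ] Y)) ⟨?_, ?_⟩
  · refine equiv_id_of_sub_eq hS1 (E.symm : Y →L[ℂ] Y) (E : Y →L[ℂ] Y) fun y => ?_
    simp [h]
  · refine equiv_id_of_sub_eq hS2 (G.symm : Y →L[ℂ] Y) (G : Y →L[ℂ] Y) fun y => ?_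
    have h1 : C (E.symm (S (G y))) = G.symm (D (S (G y))) := by
      rw [ContinuousLinearEquiv.eq_symm_apply, h, E.apply_symm_apply]
    simp [h1]

theorem isFredholm_iff_of_intertwine (h : ∀ y, G (C y) = D (E y)) :
    C.IsFredholm ↔ D.IsFredholm :=
  ⟨isFredholm_of_intertwine (G := G.symm) (E := E.symm) fun y => by
    rw [ContinuousLinearEquiv.symm_apply_eq, h, E.apply_symm_apply], isFredholm_of_intertwine h⟩

/-- If `G C = D E` with invertible `G` and `E`, then `E` maps `ker C` onto `ker D`. -/
noncomputable def kerEquivOfIntertwine (h : ∀ y, G (C y) = D (E y)) : C.ker ≃ₗ[ℂ] D.ker :=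
  E.toLinearEquiv.submoduleMap C.ker |>.trans <| LinearEquiv.ofEq _ _ <| by
    ext y
    rw [Submodule.mem_map_equiv]
    have := h (E.symm y)
    rw [E.apply_symm_apply] at this
    change C (E.symm y) = 0 ↔ D y = 0
    rw [← this, map_eq_zero_iff G G.injective]

/-- If `G C = D E` with invertible `G` and `E`, then the adjoint of `G` maps `coker D` onto
`coker C`. -/
noncomputable def cokerEquivOfIntertwine (h : ∀ y, G (C y) = D (E y)) :
    coker D ≃ₗ[ℂ] coker C where
  toFun g := ⟨g.1 ∘L (G : Y →L[ℂ] Y), mem_coker.2 fun y => by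
    have := mem_coker.1 g.2 (E y)
    rwa [← h] at this⟩
  map_add' _ _ := rfl
  map_smul' _ _ := rfl
  invFun g := ⟨g.1 ∘L (G.symm : Y →L[ℂ] Y), mem_coker.2 fun y => by
    have h1 := h (E.symm y)
    rw [E.apply_symm_apply] at h1
    change g.1 (G.symm (D y)) = 0
    rw [← h1, G.symm_apply_apply, mem_coker.1 g.2]⟩
  left_inv g := by
    ext y
    exact congrArg g.1 (G.apply_symm_apply y)
  right_inv g := by
    ext y
    exact congrArg g.1 (G.symm_apply_apply y)

/-- If `A Π + (1 - Π)` and `B Π + (1 - Π)` are equivalent operators, then the compressions of `A`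
and `B` to the range of `Π` have the same kernel and cokernel dimensions and are simultaneously
Fredholm. -/
theorem compression_invariants_of_intertwine {X : Type*} [NormedAddCommGroup X]
    [NormedSpace ℂ X] {i : X →L[ℂ] Y} {r : Y →L[ℂ] X} (hri : ∀ x, r (i x) = x) {A B : Y →L[ℂ] Y}
    (h : ∀ y, G (paired i r A y) = paired i r B (E y)) :
    ((r ∘L A ∘L i).IsFredholm ↔ (r ∘L B ∘L i).IsFredholm) ∧
      index (r ∘L A ∘L i) = index (r ∘L B ∘L i) ∧
      Module.rank ℂ (r ∘L A ∘L i).ker = Module.rank ℂ (r ∘L B ∘L i).ker ∧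
      Module.rank ℂ (coker (r ∘L A ∘L i)) = Module.rank ℂ (coker (r ∘L B ∘L i)) := by
  have eker := (kerPairedEquiv hri A).symm.trans
    ((kerEquivOfIntertwine h).trans (kerPairedEquiv hri B))
  have ecoker := (cokerPairedEquiv hri A).symm.trans
    ((cokerEquivOfIntertwine h).symm.trans (cokerPairedEquiv hri B))
  refine ⟨?_, ?_, eker.rank_eq, ecoker.rank_eq⟩
  · rw [← isFredholm_paired_iff hri, ← isFredholm_paired_iff hri]
    exact isFredholm_iff_of_intertwine h
  · rw [index, index, eker.finrank_eq, ecoker.finrank_eq]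

end Equivalence

/-! ### Toeplitz plus Hankel operators as compressions -/

section ToeplitzPlusHankel

variable (p : ℝ≥0∞) [Fact (1 < p)]

/-- The space `L^p × L^p`. -/
abbrev LpPair : Type := Lp ℂ p torusMeasure × Lp ℂ p torusMeasure

/-- The operator `(u, v) ↦ (u + v, J (u - v))` on `L^p × L^p`, with inverse
`(u, v) ↦ ((u + J v) / 2, (u - J v) / 2)`. -/
noncomputable def flipMix : LpPair p ≃L[ℂ] LpPair p :=
  .equivOfInverse
    (ContinuousLinearMap.prod (ContinuousLinearMap.fst ℂ _ _ + ContinuousLinearMap.snd ℂ _ _)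
      (flipOp p ∘L (ContinuousLinearMap.fst ℂ _ _ - ContinuousLinearMap.snd ℂ _ _)))
    (ContinuousLinearMap.prod ((1 / 2 : ℂ) • (ContinuousLinearMap.fst ℂ _ _ +
        flipOp p ∘L ContinuousLinearMap.snd ℂ _ _))
      ((1 / 2 : ℂ) • (ContinuousLinearMap.fst ℂ _ _ -
        flipOp p ∘L ContinuousLinearMap.snd ℂ _ _)))
    (fun ⟨u, v⟩ => by
      ext1 <;> simp only [ContinuousLinearMap.prod_apply, ContinuousLinearMap.comp_apply,
        _root_.add_apply, _root_.sub_apply, _root_.smul_apply, ContinuousLinearMap.coe_fst',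
        ContinuousLinearMap.coe_snd', flipOp_flipOp] <;> module)
    (fun ⟨u, v⟩ => by
      ext1 <;> simp only [ContinuousLinearMap.prod_apply, ContinuousLinearMap.comp_apply,
        _root_.add_apply, _root_.sub_apply, _root_.smul_apply, ContinuousLinearMap.coe_fst',
        ContinuousLinearMap.coe_snd', map_sub, map_add, map_smul, flipOp_flipOp] <;> module)

theorem flipMix_apply (u v : Lp ℂ p torusMeasure) :
    flipMix p (u, v) = (u + v, flipOp p (u - v)) := rfl

/-- Multiplication by the triangular matrix function with rows `(1, -b c)` and `(0, c)`, where
`c` is a unit; the inverse matrix has the rows `(1, b)` and `(0, c⁻¹)`. -/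
noncomputable def triangularMul (c : Linfˣ) (b : Linf) : LpPair p ≃L[ℂ] LpPair p :=
  .equivOfInverse
    (ContinuousLinearMap.prod
      (ContinuousLinearMap.fst ℂ _ _ - mulOp p (b * c) ∘L ContinuousLinearMap.snd ℂ _ _)
      (mulOp p c ∘L ContinuousLinearMap.snd ℂ _ _))
    (ContinuousLinearMap.prod
      (ContinuousLinearMap.fst ℂ _ _ + mulOp p b ∘L ContinuousLinearMap.snd ℂ _ _)
      (mulOp p (c⁻¹ : Linfˣ) ∘L ContinuousLinearMap.snd ℂ _ _))
    (fun ⟨u, v⟩ => by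
      ext1 <;> simp only [ContinuousLinearMap.prod_apply, ContinuousLinearMap.comp_apply,
        _root_.add_apply, _root_.sub_apply, ContinuousLinearMap.coe_fst',
        ContinuousLinearMap.coe_snd', ← mulOp_mul, Units.inv_mul, mulOp_one, sub_add_cancel])
    (fun ⟨u, v⟩ => by
      ext1 <;> simp only [ContinuousLinearMap.prod_apply, ContinuousLinearMap.comp_apply,
        _root_.add_apply, _root_.sub_apply, ContinuousLinearMap.coe_fst',
        ContinuousLinearMap.coe_snd', ← mulOp_mul, mul_assoc, Units.mul_inv, mul_one, mulOp_one,
        add_sub_cancel_right])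

theorem triangularMul_apply (c : Linfˣ) (b : Linf) (u v : Lp ℂ p torusMeasure) :
    triangularMul p c b (u, v) = (u - mulOp p (b * c) v, mulOp p c v) := rfl

/-- The operator `diag(a + b J, a - b J)` on `L^p × L^p`. -/
noncomputable def diagMulFlip (a b : Linf) : LpPair p →L[ℂ] LpPair p :=
  (mulOp p a + mulOp p b ∘L flipOp p).prodMap (mulOp p a - mulOp p b ∘L flipOp p)

/-- Multiplication by the matrix function `U` on `L^p × L^p`. -/
noncomputable def blockMul (U : Matrix (Fin 2) (Fin 2) Linf) : LpPair p →L[ℂ] LpPair p :=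
  ((mulOp p (U 0 0)).coprod (mulOp p (U 0 1))).prod
    ((mulOp p (U 1 0)).coprod (mulOp p (U 1 1)))

/-- The inclusion of `H^p × H^p` into `L^p × L^p`. -/
noncomputable def hardyIncl : (Hp p × Hp p) →L[ℂ] LpPair p :=
  (Hp p).subtypeL.prodMap (Hp p).subtypeL

variable [Fact (p ≠ ∞)]

/-- The Riesz projection of `L^p × L^p`, as a map onto `H^p × H^p`. -/
noncomputable def hardyProj : LpPair p →L[ℂ] (Hp p × Hp p) :=
  ((rieszProjection p).codRestrict (Hp p) (rieszProjection_mem p)).prodMap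
    ((rieszProjection p).codRestrict (Hp p) (rieszProjection_mem p))

theorem hardyProj_hardyIncl (x : Hp p × Hp p) : hardyProj p (hardyIncl p x) = x :=
  Prod.ext (Subtype.ext (rieszProjection_of_mem p x.1.2))
    (Subtype.ext (rieszProjection_of_mem p x.2.2))

/-- On `H^p` the factor `Q` in the Hankel operator is redundant, since `J` maps `H^p` into the range
of `Q`. -/
theorem hankel_apply (b : Linf) (f : Hp p) :
    (hankel p b f : Lp ℂ p torusMeasure) = rieszProjection p (mulOp p b (flipOp p f)) := by
  change rieszProjection p (mulOp p b (flipOp p f - rieszProjection p (flipOp p f))) = _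
  rw [rieszProjection_flipOp, rieszProjection_of_mem p f.2, sub_self, sub_zero]

theorem compress_diagMulFlip (a b : Linf) :
    hardyProj p ∘L diagMulFlip p a b ∘L hardyIncl p = diagToeplitzHankel p a b := by
  refine ContinuousLinearMap.ext fun ⟨f, g⟩ => Prod.ext (Subtype.ext ?_) (Subtype.ext ?_)
  · change rieszProjection p (mulOp p a f + mulOp p b (flipOp p f)) =
      rieszProjection p (mulOp p a f) + hankel p b f
    rw [map_add, hankel_apply]
  · change rieszProjection p (mulOp p a g - mulOp p b (flipOp p g)) =
      rieszProjection p (mulOp p a g) - hankel p b g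
    rw [map_sub, hankel_apply]

theorem compress_blockMul (U : Matrix (Fin 2) (Fin 2) Linf) :
    hardyProj p ∘L blockMul p U ∘L hardyIncl p = blockToeplitz p U := by
  refine ContinuousLinearMap.ext fun ⟨f, g⟩ => Prod.ext (Subtype.ext ?_) (Subtype.ext ?_)
  · exact map_add (rieszProjection p) (mulOp p (U 0 0) f) (mulOp p (U 0 1) g)
  · exact map_add (rieszProjection p) (mulOp p (U 1 0) f) (mulOp p (U 1 1) g)

/-- The identity `N⁻¹ S (diag(a + b J, a - b J) P + Q) = (U(a, b) P + Q) S`, where `S` is the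
operator `flipMix` and `N` is the multiplication by the matrix function that has the rows `(1, b)`
and `(0, ã)`. -/
theorem triangularMul_flipMix_paired (a : Linfˣ) (b : Linf) (y : LpPair p) :
    ((flipMix p).trans (triangularMul p (Units.map (tilde : Linf →* Linf) a)⁻¹ b))
        (paired (hardyIncl p) (hardyProj p) (diagMulFlip p a b) y) =
      paired (hardyIncl p) (hardyProj p) (blockMul p (matrixU a b)) (flipMix p y) := by
  obtain ⟨u, v⟩ := y
  set c : Linfˣ := (Units.map (tilde : Linf →* Linf) a)⁻¹
  have hca : (c : Linf) * tilde a = 1 := Units.inv_mul (Units.map (tilde : Linf →* Linf) a)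
  have hU : matrixU a b = !![(a : Linf) - b * tilde b * c, -(b * c); tilde b * c, (c : Linf)] := rfl
  have e1 : b * tilde b * c = b * c * tilde b := by ring
  have e2 : ∀ f, mulOp p (c : Linf) (mulOp p (tilde a) f) = f := fun f => by
    rw [← mulOp_mul, hca, mulOp_one]
  rw [hU]
  change triangularMul p c b (flipMix p
      (mulOp p a (rieszProjection p u) + mulOp p b (flipOp p (rieszProjection p u))
          + (u - rieszProjection p u),
        mulOp p a (rieszProjection p v) - mulOp p b (flipOp p (rieszProjection p v))
          + (v - rieszProjection p v))) =
    (mulOp p ((a : Linf) - b * tilde b * c) (rieszProjection p (u + v))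
        + mulOp p (-(b * c)) (rieszProjection p (flipOp p (u - v)))
        + (u + v - rieszProjection p (u + v)),
      mulOp p (tilde b * c) (rieszProjection p (u + v))
        + mulOp p c (rieszProjection p (flipOp p (u - v)))
        + (flipOp p (u - v) - rieszProjection p (flipOp p (u - v))))
  rw [flipMix_apply, triangularMul_apply, e1, mul_comm (tilde b)]
  -- `P J = J - J P`, `J f = f̃ J` and `J² = 1` bring every term into the form of a product of
  -- multiplications, `J` at most once and `P` at most once, in this order
  simp only [mulOp_sub, mulOp_neg, mulOp_mul, rieszProjection_flipOp, map_add, map_sub,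
    flipOp_mulOp, flipOp_flipOp, e2]
  ext1 <;> module

end ToeplitzPlusHankel

end ToeplitzHankel

theorem mainTheorem4 (p : ENNReal) [Fact (1 < p)] [Fact (p ≠ ⊤)]
    (a : ToeplitzHankel.Linfˣ) (b : ToeplitzHankel.Linf) :
    ((ToeplitzHankel.diagToeplitzHankel p a b).IsFredholm ↔
      (ToeplitzHankel.blockToeplitz p (ToeplitzHankel.matrixU a b)).IsFredholm) ∧
    ((ToeplitzHankel.diagToeplitzHankel p a b).IsFredholm →
      ToeplitzHankel.index (ToeplitzHankel.diagToeplitzHankel p a b) =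
        ToeplitzHankel.index (ToeplitzHankel.blockToeplitz p (ToeplitzHankel.matrixU a b))) ∧
    Module.rank ℂ (ToeplitzHankel.diagToeplitzHankel p a b).ker =
      Module.rank ℂ (ToeplitzHankel.blockToeplitz p (ToeplitzHankel.matrixU a b)).ker ∧
    Module.rank ℂ (ToeplitzHankel.coker (ToeplitzHankel.diagToeplitzHankel p a b)) =
      Module.rank ℂ (ToeplitzHankel.coker
        (ToeplitzHankel.blockToeplitz p (ToeplitzHankel.matrixU a b))) := by
  have key := ToeplitzHankel.compression_invariants_of_intertwine
    (ToeplitzHankel.hardyProj_hardyIncl p) (ToeplitzHankel.triangularMul_flipMix_paired p a b)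
  rw [ToeplitzHankel.compress_diagMulFlip, ToeplitzHankel.compress_blockMul] at key
  exact ⟨key.1, fun _ => key.2.1, key.2.2⟩
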